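/- For $n\ge 0$ let $S_n$ be the set of permutations of $\{1,\dots,n\}$ (with $S_0=\{\emptyset\}$), written in one-line notation $w=w(1)\cdots w(n)$. For $w\in S_n$ let $\mathfrak S_w$ be its Schubert polynomial, i.e. $\mathfrak S_{n\cdots 21}=x_1^{n-1}x_2^{n-2}\cdots x_{n-1}$ and $\mathfrak S_w=\partial_i\,\mathfrak S_{ws_i}$ whenever $w(i)<w(i+1)$, where $ws_i$ is $w$ with $w(i)$ and $w(i+1)$ interchanged, and $\partial_i f=\dfrac{f-s_if}{x_i-x_{i+1}}$ with $s_i$ interchanging the variables $x_i$ and $x_{i+1}$. Put $\Upsilon_w=\mathfrak S_w(1,1,\dots,1)$. For words $u,v$ of distinct positive integers write $u\le v$ if $u$ is a (possibly empty, not necessarily contiguous) subword of $v$; $|u|$ is the number of entries of $u$, and $\mathrm{perm}(u)\in S_{|u|}$ is the permutation whose entries have the same relative order as those of $u$. For permutations $v,w$ let $p_v(w)$ be the number of subwords of $w$ whose $\mathrm{perm}$ is $v$; $w$ avoids $1423$ if $p_{1423}(w)=0$. Define integers $c_w$ recursively by $c_\emptyset=1$ and, for $w\in S_n$ with $n\ge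 1$, $$c_w=\Upsilon_w-\sum_{0\le m<n}\ \sum_{v\in S_m}c_v\,p_v(w).$$ **Corollary.** Let $w\in S_n$ be a permutation avoiding $1423$. (1) (The Mészáros–Tanjaya conjecture for $w$.) For every subword $u$ of $w$, $$\sum_{u\le v\le w}(-1)^{|w|-|v|}\,\Upsilon_{\mathrm{perm}(v)}\ \ge\ 0 .$$ (2) (Gao's conjecture for $w$.) We have $c_w\ge 0$. Moreover $$\Upsilon_w=\sum_{0\le m\le n}\ \sum_{v\in S_m}c_v\,p_v(w),$$ and $c_v\ge 0$ for every permutation $v$ with $p_v(w)>0$. -/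

import Mathlib

noncomputable section

namespace SchubertSpec

open MvPolynomial

/-! ### Schubert polynomials

`S_n` is `Equiv.Perm (Fin n)`; positions and values are counted from `0`, and the variable called
`x_{i+1}` in the usual notation is `X i`. -/

/-- The action of the simple transposition exchanging the variables `X i` and `X (i + 1)`. -/
def swapVars (i : ℕ) (f : MvPolynomial ℕ ℤ) : MvPolynomial ℕ ℤ :=
  rename (Equiv.swap i (i + 1)) f

theorem dvd_sub_swapVars (i : ℕ) (f : MvPolynomial ℕ ℤ) :
    (X i - X (i + 1) : MvPolynomial ℕ ℤ) ∣ f - swapVars i f := by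
  unfold swapVars
  induction f using MvPolynomial.induction_on with
  | C a => simp
  | add p q hp hq =>
    have h := dvd_add hp hq
    rw [map_add]
    convert h using 1
    ring
  | mul_X p k hp =>
    have hk : (X i - X (i + 1) : MvPolynomial ℕ ℤ) ∣ X k - X (Equiv.swap i (i + 1) k) := by
      by_cases h1 : k = i
      · subst h1; simp
      · by_cases h2 : k = i + 1
        · subst h2
          rw [Equiv.swap_apply_right]
          exact ⟨-1, by ring⟩
        · rw [Equiv.swap_apply_of_ne_of_ne h1 h2]; simp
    have h := dvd_add (hp.mul_right (X k))
      (hk.mul_left (rename (Equiv.swap i (i + 1)) p))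
    rw [map_mul, rename_X]
    convert h using 1
    ring

/-- The divided difference operator `∂_i f = (f - s_i f) / (x_i - x_{i+1})`: the (unique) quotient
of this exact division. -/
def divDiff (i : ℕ) (f : MvPolynomial ℕ ℤ) : MvPolynomial ℕ ℤ :=
  (dvd_sub_swapVars i f).choose

theorem divDiff_spec (i : ℕ) (f : MvPolynomial ℕ ℤ) :
    f - swapVars i f = (X i - X (i + 1)) * divDiff i f :=
  (dvd_sub_swapVars i f).choose_spec

theorem divDiff_unique (i : ℕ) (f g : MvPolynomial ℕ ℤ)
    (h : f - swapVars i f = (X i - X (i + 1)) * g) : divDiff i f = g := by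
  have hne : (X i - X (i + 1) : MvPolynomial ℕ ℤ) ≠ 0 := by
    rw [sub_ne_zero]
    intro h
    have := X_injective h
    omega
  exact mul_left_cancel₀ hne ((divDiff_spec i f).symm.trans h)

/-- `w` has an ascent at position `i`, that is, `w(i) < w(i+1)`. -/
def IsAscent {n : ℕ} (w : Equiv.Perm (Fin n)) (i : ℕ) : Prop :=
  ∃ h : i + 1 < n, w ⟨i, Nat.lt_of_succ_lt h⟩ < w ⟨i + 1, h⟩

/-- `w s_i`, that is, `w` with the values `w(i)` and `w(i+1)` interchanged. -/
def mulSimple {n : ℕ} (w : Equiv.Perm (Fin n)) (i : ℕ) (h : i + 1 < n) : Equiv.Perm (Fin n) :=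
  w * Equiv.swap ⟨i, Nat.lt_of_succ_lt h⟩ ⟨i + 1, h⟩

/-- A quantity that decreases from `w` to `w s_i` at an ascent `i`; it is used only to show that
the recursion for Schubert polynomials terminates. -/
def potential {n : ℕ} (w : Equiv.Perm (Fin n)) : ℕ :=
  ∑ k : Fin n, (k : ℕ) * (w k : ℕ)

theorem potential_mulSimple_lt {n : ℕ} (w : Equiv.Perm (Fin n)) (i : ℕ) (h : IsAscent w i) :
    potential (mulSimple w i h.1) < potential w := by
  obtain ⟨hi, hw⟩ := h
  set a : Fin n := ⟨i, Nat.lt_of_succ_lt hi⟩ with ha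
  set b : Fin n := ⟨i + 1, hi⟩ with hb
  have hab : a ≠ b := by simp [ha, hb]
  have key : ∀ v : Equiv.Perm (Fin n), potential v =
      (a : ℕ) * (v a : ℕ) + ((b : ℕ) * (v b : ℕ) +
        ∑ k ∈ (Finset.univ.erase a).erase b, (k : ℕ) * (v k : ℕ)) := by
    intro v
    unfold potential
    rw [Finset.add_sum_erase (Finset.univ.erase a) (fun k : Fin n => (k : ℕ) * (v k : ℕ))
        (by simp [hab.symm]),
      Finset.add_sum_erase Finset.univ (fun k : Fin n => (k : ℕ) * (v k : ℕ)) (by simp)]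
  rw [key, key w]
  have h3 : ∑ k ∈ (Finset.univ.erase a).erase b, (k : ℕ) * (mulSimple w i hi k : ℕ) =
      ∑ k ∈ (Finset.univ.erase a).erase b, (k : ℕ) * (w k : ℕ) := by
    refine Finset.sum_congr rfl fun k hk => ?_
    simp only [Finset.mem_erase, Finset.mem_univ, and_true] at hk
    simp only [mulSimple, Equiv.Perm.mul_apply]
    rw [Equiv.swap_apply_of_ne_of_ne hk.2 hk.1]
  rw [h3]
  have e1 : mulSimple w i hi a = w b := by simp [mulSimple, ha, hb]
  have e2 : mulSimple w i hi b = w a := by simp [mulSimple, ha, hb]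
  rw [e1, e2]
  have h4 : (w a : ℕ) < (w b : ℕ) := hw
  have h5 : (a : ℕ) = i := rfl
  have h6 : (b : ℕ) = i + 1 := rfl
  rw [h5, h6]
  nlinarith

open Classical in
/-- The Schubert polynomial of `w ∈ S_n`. If `w` has an ascent, then it is `∂_i` of the Schubert
polynomial of `w s_i` for an ascent `i` of `w`; the result does not depend on the ascent, and
the first one is taken. The only permutation without an ascent is the longest one, whose Schubert
polynomial is `x_1^{n-1} x_2^{n-2} ⋯ x_{n-1}`. -/
def schubert {n : ℕ} (w : Equiv.Perm (Fin n)) : MvPolynomial ℕ ℤ :=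
  if h : ∃ i, IsAscent w i then
    divDiff (Nat.find h) (schubert (mulSimple w (Nat.find h) (Nat.find_spec h).1))
  else
    ∏ i ∈ Finset.range n, X i ^ (n - 1 - i)
termination_by potential w
decreasing_by exact potential_mulSimple_lt w _ (Nat.find_spec h)

/-- The principal specialization `Υ_w`: the Schubert polynomial of `w` at `x_i = 1`. -/
def upsilon {n : ℕ} (w : Equiv.Perm (Fin n)) : ℤ :=
  eval (fun _ => 1) (schubert w)

/-! ### Words, subwords and patterns

Words of positive integers are lists of natural numbers, and `u ≤ v` (`u` is a subword of `v`) is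
`List.Sublist u v`. -/

/-- The one-line notation `w(1) w(2) ⋯ w(n)` of a permutation, with values in `{1, …, n}`. -/
def oneLine {n : ℕ} (w : Equiv.Perm (Fin n)) : List ℕ :=
  List.ofFn fun i => (w i : ℕ) + 1

/-- `perm(u)`: the permutation with the same relative order as the word `u`
(see `wordPerm_lt_iff`). -/
def wordPerm (u : List ℕ) : Equiv.Perm (Fin u.length) :=
  (Tuple.sort u.get)⁻¹

theorem wordPerm_lt_iff (u : List ℕ) (hu : u.Nodup) (i j : Fin u.length) :
    wordPerm u i < wordPerm u j ↔ u.get i < u.get j := by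
  have hinj : Function.Injective u.get := List.nodup_iff_injective_get.1 hu
  have hm : StrictMono (u.get ∘ Tuple.sort u.get) :=
    (Tuple.monotone_sort u.get).strictMono_of_injective
      (hinj.comp (Tuple.sort u.get).injective)
  have h := hm.lt_iff_lt (a := wordPerm u i) (b := wordPerm u j)
  rw [← h]
  simp [wordPerm]

/-- The finite set of words `v` with `u ≤ v ≤ w`. -/
def wordsBetween (u w : List ℕ) : Finset (List ℕ) :=
  w.sublists.toFinset.filter fun v => List.Sublist u v

theorem mem_wordsBetween (u v w : List ℕ) :
    v ∈ wordsBetween u w ↔ List.Sublist u v ∧ List.Sublist v w := by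
  simp [wordsBetween, and_comm]

/-- `p_u(w)`: the number of subwords `v` of `w` with `perm(v) = u` (as words). -/
def patternCount {m n : ℕ} (u : Equiv.Perm (Fin m)) (w : Equiv.Perm (Fin n)) : ℕ :=
  ((wordsBetween [] (oneLine w)).filter fun v => oneLine (wordPerm v) = oneLine u).card

/-- `w` does not contain the pattern `1423`. -/
def Avoids1423 {n : ℕ} (w : Equiv.Perm (Fin n)) : Prop :=
  ∀ v : List ℕ, List.Sublist v (oneLine w) → oneLine (wordPerm v) ≠ [1, 4, 2, 3]

/-- The numbers `c_w`: `c_∅ = 1`, and `c_w = Υ_w - ∑ c_v p_v(w)` for `w ∈ S_n` with `n ≥ 1`, where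
the sum is over `v ∈ S_m` with `0 ≤ m < n`. -/
def coeffC : {n : ℕ} → Equiv.Perm (Fin n) → ℤ
  | 0, _ => 1
  | n + 1, w =>
    upsilon w - ∑ m : Fin (n + 1), ∑ v : Equiv.Perm (Fin m), coeffC v * (patternCount v w : ℤ)
termination_by n => n
decreasing_by exact m.isLt

end SchubertSpec

end

/-
The operators which remove a descent from a word satisfy the nil-Coxeter relations, and the
Schubert polynomials are the coefficients of the Fomin–Stanley product of factors `1 + x u_i`; by
the Yang–Baxter relation, this product behaves under the exchange of two variables as the divided
differences demand. If all variables are `1`, the product may also be read column by column. This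
removes the smallest letter `μ` of a word `A μ B` and yields `Υ(A μ B) = ∑ Υ(A B')`, where `B'` runs
through the words obtained from `B` by letting letters jump to the left over larger ones.

The term with `B' = B` is the value at the word without `μ`. Every other `B'` is built up by jumps
of letters `m` over larger letters `a`, and is only present if `m` and `a` are. If `c` stands to the
left of `a m`, with `a < m < c`, then `m` can reach `c` only if `a` is absent; as `μ c a m` is an
occurrence of `1423`, this does not happen in a word which avoids `1423`. A jump can create new
occurrences of `1423`, but their `2` is a letter which has jumped before, so that one has to prove
the following stronger statement by induction: if a set `F` contains the `2` of every occurrence of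
`1423` in a word, then the alternating sums of `Υ` over the subwords containing a set of letters
`U ⊇ F` are nonnegative. The numbers `c_w` are such sums by Möbius inversion.
-/

noncomputable section

namespace SchubertSpec

open scoped List

section NilCoxeter

variable {R A : Type*} [CommRing R] [Ring A]

/-- The defining relations of the nil-Coxeter algebra of the infinite symmetric group, for a
sequence of elements of a ring. -/
structure IsNilCoxeter (u : ℕ → A) : Prop where
  mul_self : ∀ i, u i * u i = 0
  commute : ∀ i j, i + 1 < j → Commute (u i) (u j)
  braid : ∀ i, u i * u (i + 1) * u i = u (i + 1) * u i * u (i + 1)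

theorem IsNilCoxeter.shift {u : ℕ → A} (hu : IsNilCoxeter u) :
    IsNilCoxeter fun i => u (i + 1) where
  mul_self i := hu.mul_self (i + 1)
  commute i j hij := hu.commute (i + 1) (j + 1) (by omega)
  braid i := hu.braid (i + 1)

theorem IsNilCoxeter.commute_zero {u : ℕ → A} (hu : IsNilCoxeter u) (i : ℕ) :
    Commute (u 0) (u (i + 2)) :=
  hu.commute 0 (i + 2) (by omega)

variable [Algebra R A]

/-- The product `(1 + x u_0) (1 + x u_1) ⋯ (1 + x u_{k-1})`. -/
def row (u : ℕ → A) (x : R) : ℕ → A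
  | 0 => 1
  | k + 1 => (1 + x • u 0) * row (fun i => u (i + 1)) x k

/-- The product `(1 + x u_{k-1}) ⋯ (1 + x u_1) (1 + x u_0)`. -/
def column (u : ℕ → A) (x : R) : ℕ → A
  | 0 => 1
  | k + 1 => (1 + x • u k) * column u x k

/-- The Fomin–Stanley product: its expansion in the standard basis of the nil-Coxeter algebra of
`S_k` has the Schubert polynomials as coefficients, evaluated at the point `x`. -/
def schubertProduct (u : ℕ → A) (x : ℕ → R) : ℕ → A
  | 0 => 1
  | k + 1 => schubertProduct (fun i => u (i + 1)) (fun i => x (i + 1)) k * row u (x 0) k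

theorem commute_one_add_smul {a b : A} (h : Commute a b) (x : R) : Commute a (1 + x • b) :=
  (Commute.one_right a).add_right (h.smul_right x)

theorem commute_row {a : A} {u : ℕ → A} (h : ∀ i, Commute a (u i)) (x : R) (k : ℕ) :
    Commute a (row u x k) := by
  induction k generalizing u with
  | zero => exact Commute.one_right a
  | succ k ih => exact (commute_one_add_smul (h 0) x).mul_right (ih fun i => h (i + 1))

theorem commute_schubertProduct {a : A} {u : ℕ → A} (h : ∀ i, Commute a (u i)) (x : ℕ → R)
    (k : ℕ) : Commute a (schubertProduct u x k) := by
  induction k generalizing u x with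
  | zero => exact Commute.one_right a
  | succ k ih => exact (ih (fun i => h (i + 1)) _).mul_right (commute_row h _ k)

theorem column_succ' (u : ℕ → A) (x : R) (k : ℕ) :
    column u x (k + 1) = column (fun i => u (i + 1)) x k * (1 + x • u 0) := by
  induction k with
  | zero => simp only [column, mul_one, one_mul]
  | succ k ih => rw [column, ih, column, mul_assoc]

namespace IsNilCoxeter

variable {u : ℕ → A} (hu : IsNilCoxeter u)

include hu

theorem one_sub_smul_mul_one_add_smul (x : R) (i : ℕ) :
    (1 - x • u i) * (1 + x • u i) = 1 := by
  simp only [sub_mul, mul_add, mul_one, one_mul, smul_mul_smul_comm, hu.mul_self, smul_zero]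
  abel

theorem row_shift (x : R) (k : ℕ) :
    row (fun i => u (i + 1)) x k = (1 - x • u 0) * row u x (k + 1) := by
  rw [row, ← mul_assoc, hu.one_sub_smul_mul_one_add_smul, one_mul]

/-- A consequence of the Yang–Baxter relation; the point is the symmetry in `x` and `y`. -/
theorem yangBaxter (x y : R) :
    (1 + x • u 0) * (1 + x • u 1) * (1 + y • u 0) * (1 - x • u 1) =
      1 + (x + y) • u 0 + (x * y) • (u 1 * u 0 - u 0 * u 1) := by
  have h₀ : u 0 * u 0 = 0 := hu.mul_self 0
  have h₁ : u 1 * u 1 = 0 := hu.mul_self 1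
  have braid : u 1 * u 0 * u 1 = u 0 * u 1 * u 0 := (hu.braid 0).symm
  have h₀₁₁ : u 0 * u 1 * u 1 = 0 := by rw [mul_assoc, h₁, mul_zero]
  have h₀₁₀₁ : u 0 * u 1 * u 0 * u 1 = 0 := by rw [← braid, mul_assoc, h₁, mul_zero]
  simp only [mul_add, add_mul, mul_sub, mul_one, one_mul, smul_mul_assoc,
    mul_smul_comm, h₀, h₁, braid, h₀₁₁, h₀₁₀₁, smul_zero, zero_mul]
  module

theorem row_mul_row_succ_succ (x y : R) (k : ℕ) :
    row u x (k + 2) * row u y (k + 2) =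
      ((1 + x • u 0) * (1 + x • u 1) * (1 + y • u 0) * (1 - x • u 1)) *
        (row (fun i => u (i + 1)) x (k + 1) * row (fun i => u (i + 1)) y (k + 1)) := by
  have hcomm : row (fun i => u (i + 2)) x k * (1 + y • u 0) =
      (1 + y • u 0) * row (fun i => u (i + 2)) x k :=
    ((Commute.one_left _).add_left ((commute_row hu.commute_zero x k).smul_left y)).eq.symm
  calc row u x (k + 2) * row u y (k + 2)
      = (1 + x • u 0) * (1 + x • u 1) * (row (fun i => u (i + 2)) x k * (1 + y • u 0)) *
          row (fun i => u (i + 1)) y (k + 1) := by simp only [row, mul_assoc]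
    _ = (1 + x • u 0) * (1 + x • u 1) * (1 + y • u 0) * row (fun i => u (i + 2)) x k *
          row (fun i => u (i + 1)) y (k + 1) := by rw [hcomm]; simp only [mul_assoc]
    _ = _ := by rw [hu.shift.row_shift x k]; simp only [mul_assoc]

theorem row_mul_row_comm (x y : R) (k : ℕ) :
    row u x k * row u y k = row u y k * row u x k := by
  induction k generalizing u with
  | zero => rfl
  | succ k ih =>
    rcases k with _ | k
    · have h : Commute (x • u 0) (y • u 0) := ((Commute.refl (u 0)).smul_left x).smul_right y
      simpa only [row, mul_one] using
        ((Commute.one_left _).add_left ((Commute.one_right _).add_right h)).eq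
    · rw [hu.row_mul_row_succ_succ, hu.row_mul_row_succ_succ, ih hu.shift, hu.yangBaxter,
        hu.yangBaxter, add_comm x y, mul_comm x y]

theorem schubertProduct_succ_succ (x : ℕ → R) (k : ℕ) :
    schubertProduct u x (k + 2) =
      (1 - x 1 • u 0) * (schubertProduct (fun i => u (i + 2)) (fun i => x (i + 2)) k *
        (row u (x 1) (k + 1) * row u (x 0) (k + 1))) := by
  have hcomm : schubertProduct (fun i => u (i + 2)) (fun i => x (i + 2)) k * (1 - x 1 • u 0) =
      (1 - x 1 • u 0) * schubertProduct (fun i => u (i + 2)) (fun i => x (i + 2)) k :=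
    ((Commute.one_right _).sub_right
      ((commute_schubertProduct hu.commute_zero _ k).symm.smul_right (x 1))).eq
  rw [schubertProduct, schubertProduct, hu.row_shift, ← mul_assoc (schubertProduct _ _ _), hcomm]
  simp only [mul_assoc]

theorem schubertProduct_sub_swap (x : ℕ → R) {i k : ℕ} (hik : i + 1 < k) :
    schubertProduct u x k - schubertProduct u (x ∘ Equiv.swap i (i + 1)) k =
      (x i - x (i + 1)) • (u i * schubertProduct u x k) := by
  induction i generalizing u x k with
  | zero =>
    obtain ⟨k, rfl⟩ := Nat.exists_eq_add_of_le' hik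
    have hx : (fun i => (x ∘ Equiv.swap 0 1) (i + 2)) = fun i => x (i + 2) :=
      funext fun i => congrArg x (Equiv.swap_apply_of_ne_of_ne (by omega) (by omega))
    have hu_zero : u 0 * (1 - x 1 • u 0) = u 0 := by
      rw [mul_sub, mul_one, mul_smul_comm, hu.mul_self, smul_zero, sub_zero]
    rw [hu.schubertProduct_succ_succ, hu.schubertProduct_succ_succ, zero_add, hx,
      Function.comp_apply, Function.comp_apply, Equiv.swap_apply_left, Equiv.swap_apply_right,
      hu.row_mul_row_comm (x 0) (x 1), ← mul_assoc (u 0), hu_zero, ← sub_mul, ← smul_mul_assoc]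
    congr 1
    module
  | succ i ih =>
    obtain ⟨k, rfl⟩ := Nat.exists_eq_add_of_le' (show 1 ≤ k by omega)
    have hx : (fun j => (x ∘ Equiv.swap (i + 1) (i + 2)) (j + 1)) =
        (fun j => x (j + 1)) ∘ Equiv.swap i (i + 1) := by
      funext j
      simp only [Function.comp_apply, Equiv.swap_apply_def]
      grind
    rw [schubertProduct, schubertProduct, hx, Function.comp_apply,
      Equiv.swap_apply_of_ne_of_ne (by omega) (by omega), ← sub_mul,
      ih hu.shift _ (by omega), smul_mul_assoc, mul_assoc]

theorem schubertProduct_const_succ (x : R) (k : ℕ) :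
    schubertProduct u (fun _ => x) (k + 1) =
      column u x k * schubertProduct (fun i => u (i + 1)) (fun _ => x) k := by
  induction k generalizing u with
  | zero => rfl
  | succ k ih =>
    have hcomm : schubertProduct (fun i => u (i + 2)) (fun _ => x) k * (1 + x • u 0) =
        (1 + x • u 0) * schubertProduct (fun i => u (i + 2)) (fun _ => x) k :=
      (commute_one_add_smul (commute_schubertProduct hu.commute_zero _ k).symm x).eq
    calc schubertProduct u (fun _ => x) (k + 2)
        = schubertProduct (fun i => u (i + 1)) (fun _ => x) (k + 1) * row u x (k + 1) := rfl
      _ = column (fun i => u (i + 1)) x k *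
            (schubertProduct (fun i => u (i + 2)) (fun _ => x) k * (1 + x • u 0)) *
            row (fun i => u (i + 1)) x k := by
          rw [ih hu.shift, row]; simp only [mul_assoc]
      _ = _ := by rw [hcomm, column_succ', schubertProduct]; simp only [mul_assoc]

end IsNilCoxeter

end NilCoxeter

section Intertwining

variable {R R' M M' : Type*} [CommRing R] [CommRing R'] [AddCommGroup M] [Module R M]
  [AddCommGroup M'] [Module R' M'] {σ : R →+* R'}

theorem map_row_apply (Φ : M →ₛₗ[σ] M') {u : ℕ → Module.End R M} {v : ℕ → Module.End R' M'}
    (h : ∀ i m, Φ (u i m) = v i (Φ m)) (x : R) (k : ℕ) (m : M) :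
    Φ (row u x k m) = row v (σ x) k (Φ m) := by
  induction k generalizing u v with
  | zero => rfl
  | succ k ih =>
    simp only [row, Module.End.mul_apply, LinearMap.add_apply, Module.End.one_apply,
      LinearMap.smul_apply, map_add, map_smulₛₗ, h, ih fun i => h (i + 1)]

theorem map_schubertProduct_apply (Φ : M →ₛₗ[σ] M') {u : ℕ → Module.End R M}
    {v : ℕ → Module.End R' M'} (h : ∀ i m, Φ (u i m) = v i (Φ m)) (x : ℕ → R) (k : ℕ) (m : M) :
    Φ (schubertProduct u x k m) = schubertProduct v (fun i => σ (x i)) k (Φ m) := by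
  induction k generalizing u v x m with
  | zero => rfl
  | succ k ih =>
    simp only [schubertProduct, Module.End.mul_apply, ih fun i => h (i + 1), map_row_apply Φ h]

end Intertwining

section Descents

variable {R R' α β : Type*} [CommRing R] [CommRing R'] [LinearOrder α] [LinearOrder β]

/-- The word obtained from `l` by exchanging its entries at positions `i` and `i + 1`, provided
that they form a descent. -/
def removeDescent : ℕ → List α → Option (List α)
  | 0, a :: b :: l => if b < a then some (b :: a :: l) else none
  | i + 1, a :: l => (removeDescent i l).map (a :: ·)
  | _, _ => none

theorem perm_of_mem_removeDescent {i : ℕ} {l r : List α} (h : r ∈ removeDescent i l) :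
    r.Perm l := by
  fun_induction removeDescent i l generalizing r with
  | case1 a b l => rw [← Option.mem_some.1 h]; exact List.Perm.swap a b l
  | case2 => cases h
  | case3 i a l ih =>
    obtain ⟨s, hs, rfl⟩ := Option.mem_map.1 h
    exact (ih hs).cons a
  | case4 => cases h

theorem removeDescent_map {f : α → β} (hf : StrictMono f) (i : ℕ) (l : List α) :
    removeDescent i (l.map f) = (removeDescent i l).map (List.map f) := by
  fun_induction removeDescent i l with
  | case1 a b l hab => simp [removeDescent, hf.lt_iff_lt, hab]
  | case2 a b l hab => simp [removeDescent, hf.lt_iff_lt, hab]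
  | case3 i a l ih => simp [removeDescent, ih, Function.comp_def]
  | case4 i l h₁ h₂ =>
    rcases i with _ | i <;> rcases l with _ | ⟨a, _ | ⟨b, l⟩⟩ <;> simp_all [removeDescent]

variable (R α) in
/-- The `i`-th nil-Coxeter generator, acting on functions of words: `desc R α i F` takes at a word
with a descent at `i` the value of `F` at the word with that descent removed, and vanishes at the
other words. -/
def desc (i : ℕ) : Module.End R (List α → R) where
  toFun F l := (removeDescent i l).elim 0 F
  map_add' F G := by
    funext l
    cases h : removeDescent i l <;> simp [h]
  map_smul' c F := by
    funext l
    cases h : removeDescent i l <;> simp [h]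

theorem desc_apply (i : ℕ) (F : List α → R) (l : List α) :
    desc R α i F l = (removeDescent i l).elim 0 F := rfl

theorem desc_nil (i : ℕ) (F : List α → R) : desc R α i F [] = 0 := by cases i <;> rfl

theorem desc_zero_singleton (F : List α → R) (a : α) : desc R α 0 F [a] = 0 := rfl

theorem desc_zero_cons_cons (F : List α → R) (a b : α) (l : List α) :
    desc R α 0 F (a :: b :: l) = if b < a then F (b :: a :: l) else 0 := by
  rw [desc_apply, removeDescent]
  split_ifs <;> rfl

theorem desc_succ_cons (i : ℕ) (F : List α → R) (a : α) (l : List α) :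
    desc R α (i + 1) F (a :: l) = desc R α i (fun r => F (a :: r)) l := by
  rw [desc_apply, desc_apply, removeDescent]
  cases removeDescent i l <;> rfl

theorem desc_append (p q : List α) (a b : α) (F : List α → R) :
    desc R α p.length F (p ++ a :: b :: q) = if b < a then F (p ++ b :: a :: q) else 0 := by
  induction p generalizing F with
  | nil => exact desc_zero_cons_cons F a b q
  | cons c p ih => exact (desc_succ_cons _ F c _).trans (ih _)

theorem isNilCoxeter_desc : IsNilCoxeter (desc R α) where
  mul_self i := by
    ext F l
    simp only [Module.End.mul_apply, LinearMap.zero_apply, Pi.zero_apply]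
    induction i generalizing F l with
    | zero =>
      rcases l with _ | ⟨a, _ | ⟨b, l⟩⟩
      · rfl
      · rfl
      · simp only [desc_zero_cons_cons]
        split_ifs with h h' <;> first | exact absurd h h'.asymm | rfl
    | succ i ih =>
      rcases l with _ | ⟨a, l⟩
      · rfl
      · simpa only [desc_succ_cons] using ih _ l
  commute i j hij := by
    obtain ⟨k, rfl⟩ : ∃ k, j = i + k + 2 := ⟨j - i - 2, by omega⟩
    ext F l
    simp only [Module.End.mul_apply]
    clear hij
    induction i generalizing F l with
    | zero =>
      rcases l with _ | ⟨a, _ | ⟨b, l⟩⟩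
      · rfl
      · simp only [desc_zero_singleton, desc_succ_cons, desc_nil]
      · simp only [zero_add, desc_zero_cons_cons, desc_succ_cons]
        split_ifs with h
        · rfl
        · exact (congrFun (map_zero (desc R α k)) l).symm
    | succ i ih =>
      rcases l with _ | ⟨a, l⟩
      · simp only [desc_nil]
      · rw [show i + 1 + k + 2 = (i + k + 2) + 1 by omega]
        simpa only [desc_succ_cons] using ih _ l
  braid i := by
    ext F l
    simp only [Module.End.mul_apply]
    induction i generalizing F l with
    | zero =>
      rcases l with _ | ⟨a, _ | ⟨b, _ | ⟨c, l⟩⟩⟩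
      · rfl
      · rfl
      · simp only [desc_zero_cons_cons, desc_succ_cons, desc_zero_singleton, ite_self]
      · simp only [desc_zero_cons_cons, desc_succ_cons, zero_add]
        grind
    | succ i ih =>
      rcases l with _ | ⟨a, l⟩
      · simp only [desc_nil]
      · simpa only [desc_succ_cons] using ih _ l

theorem row_desc_shift_cons (x : R) (k : ℕ) (F : List α → R) (a : α) (l : List α) :
    row (fun i => desc R α (i + 1)) x k F (a :: l) =
      row (desc R α) x k (fun r => F (a :: r)) l :=
  congrFun (map_row_apply (LinearMap.funLeft R R (List.cons a))
    (fun i F => funext (desc_succ_cons i F a)) x k F) l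

theorem schubertProduct_desc_shift_cons (x : ℕ → R) (k : ℕ) (F : List α → R) (a : α)
    (l : List α) :
    schubertProduct (fun i => desc R α (i + 1)) x k F (a :: l) =
      schubertProduct (desc R α) x k (fun r => F (a :: r)) l :=
  congrFun (map_schubertProduct_apply (LinearMap.funLeft R R (List.cons a))
    (fun i F => funext (desc_succ_cons i F a)) x k F) l

theorem schubertProduct_desc_map {f : α → β} (hf : StrictMono f) (x : ℕ → R) (k : ℕ)
    (F : List β → R) (l : List α) :
    schubertProduct (desc R β) x k F (l.map f) =
      schubertProduct (desc R α) x k (fun r => F (r.map f)) l := by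
  refine congrFun (map_schubertProduct_apply (LinearMap.funLeft R R (List.map f))
    (fun i F => funext fun l => ?_) x k F) l
  simp only [LinearMap.funLeft_apply, desc_apply, removeDescent_map hf]
  cases removeDescent i l <;> rfl

theorem map_schubertProduct_desc (σ : R →+* R') (x : ℕ → R) (k : ℕ) (F : List α → R)
    (l : List α) :
    σ (schubertProduct (desc R α) x k F l) =
      schubertProduct (desc R' α) (fun i => σ (x i)) k (fun r => σ (F r)) l := by
  let Φ : (List α → R) →ₛₗ[σ] (List α → R') :=
    { toFun F l := σ (F l)
      map_add' F G := funext fun l => map_add σ (F l) (G l)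
      map_smul' c F := funext fun l => map_mul σ c (F l) }
  refine congrFun (map_schubertProduct_apply Φ (fun i F => funext fun l => ?_) x k F) l
  change σ ((removeDescent i l).elim 0 F) = (removeDescent i l).elim 0 fun r => σ (F r)
  cases removeDescent i l
  · exact map_zero σ
  · rfl

theorem desc_mul {g : List α → R} (hg : ∀ l r, l.Perm r → g l = g r) (i : ℕ) (F : List α → R) :
    desc R α i (g * F) = g * desc R α i F := by
  funext l
  rw [desc_apply, Pi.mul_apply, desc_apply]
  cases h : removeDescent i l with
  | none => exact (mul_zero _).symm
  | some r => exact congrArg (· * F r) (hg r l (perm_of_mem_removeDescent h))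

theorem row_desc_mul {g : List α → R} (hg : ∀ l r, l.Perm r → g l = g r) (x : R) (k : ℕ)
    (F : List α → R) : row (desc R α) x k (g * F) = g * row (desc R α) x k F :=
  (map_row_apply (LinearMap.mulLeft R g) (fun i F => (desc_mul hg i F).symm) x k F).symm

theorem schubertProduct_desc_mul {g : List α → R} (hg : ∀ l r, l.Perm r → g l = g r)
    (x : ℕ → R) (k : ℕ) (F : List α → R) :
    schubertProduct (desc R α) x k (g * F) = g * schubertProduct (desc R α) x k F :=
  (map_schubertProduct_apply (LinearMap.mulLeft R g) (fun i F => (desc_mul hg i F).symm)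
    x k F).symm

theorem schubertProduct_desc_congr (x : ℕ → R) (k : ℕ) {F G : List α → R} {l : List α}
    (h : ∀ r, r.Perm l → F r = G r) :
    schubertProduct (desc R α) x k F l = schubertProduct (desc R α) x k G l := by
  let g : List α → R := fun r => if r.Perm l then 1 else 0
  have hg (r s : List α) (hrs : r.Perm s) : g r = g s := by simp only [g, hrs.congr_left]
  have hFG : g * F = g * G := by
    funext r
    by_cases hr : r.Perm l <;> simp [g, hr, h]
  have := congrFun ((schubertProduct_desc_mul hg x k F).symm.trans
    ((congrArg _ hFG).trans (schubertProduct_desc_mul hg x k G))) l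
  simpa [g] using this

end Descents

section SchubertAt

variable {R R' α β : Type*} [CommRing R] [CommRing R'] [LinearOrder α] [LinearOrder β]

/-- The indicator function of the strictly increasing words. -/
def sortedInd (R : Type*) [CommRing R] (l : List α) : R := if l.Pairwise (· < ·) then 1 else 0

/-- The indicator function of the words all of whose letters are larger than `a`. -/
def aboveInd (R : Type*) [CommRing R] (a : α) (l : List α) : R := if ∀ b ∈ l, a < b then 1 else 0

theorem sortedInd_cons (a : α) (l : List α) :
    sortedInd R (a :: l) = aboveInd R a l * sortedInd R l := by
  simp only [sortedInd, aboveInd, List.pairwise_cons, ite_zero_mul_ite_zero, mul_one]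

theorem sortedInd_map {f : α → β} (hf : StrictMono f) (l : List α) :
    sortedInd R (l.map f) = sortedInd R l := by
  simp only [sortedInd, List.pairwise_map, hf.lt_iff_lt]

theorem map_sortedInd (σ : R →+* R') (l : List α) : σ (sortedInd R l) = sortedInd R' l := by
  rw [sortedInd, sortedInd, apply_ite σ, map_one, map_zero]

theorem aboveInd_perm (a : α) (l r : List α) (h : l.Perm r) : aboveInd R a l = aboveInd R a r := by
  simp only [aboveInd, h.mem_iff]

/-- The Schubert polynomial of (the standardization of) the word `l`, evaluated at the point `x`
of a commutative ring. -/
def schubertAt (x : ℕ → R) (l : List α) : R :=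
  schubertProduct (desc R α) x l.length (sortedInd R) l

theorem map_schubertAt (σ : R →+* R') (x : ℕ → R) (l : List α) :
    σ (schubertAt x l) = schubertAt (fun i => σ (x i)) l := by
  simp only [schubertAt, map_schubertProduct_desc, map_sortedInd]

theorem schubertAt_map {f : α → β} (hf : StrictMono f) (x : ℕ → R) (l : List α) :
    schubertAt x (l.map f) = schubertAt x l := by
  rw [schubertAt, schubertAt, schubertProduct_desc_map hf, List.length_map]
  exact schubertProduct_desc_congr x _ fun r _ => sortedInd_map hf r

theorem row_sortedInd_cons_of_forall_gt (x : R) {c : α} {l : List α} (h : ∀ b ∈ l, b < c) :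
    row (desc R α) x l.length (sortedInd R) (c :: l) =
      x ^ l.length * sortedInd R (l ++ [c]) := by
  have row_cons (k : ℕ) (a : α) (r : List α) :
      row (fun i => desc R α (i + 1)) x k (sortedInd R) (a :: r) =
        aboveInd R a r * row (desc R α) x k (sortedInd R) r := by
    rw [row_desc_shift_cons, funext (sortedInd_cons a)]
    exact congrFun (row_desc_mul (aboveInd_perm a) x k (sortedInd R)) r
  induction l with
  | nil => simp [row]
  | cons b l ih =>
    rw [List.forall_mem_cons] at h
    have hc : aboveInd R c (b :: l) = 0 := if_neg fun hbl => (hbl b List.mem_cons_self).asymm h.1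
    have hb : aboveInd R b (c :: l) = aboveInd R b (l ++ [c]) :=
      aboveInd_perm b _ _ (List.perm_append_singleton c l).symm
    simp only [List.length_cons, row, Module.End.mul_apply, LinearMap.add_apply,
      Module.End.one_apply, LinearMap.smul_apply, Pi.add_apply, Pi.smul_apply, smul_eq_mul,
      desc_zero_cons_cons, if_pos h.1, row_cons, hc, hb, ih h.2, List.cons_append, sortedInd_cons]
    ring

theorem schubertAt_cons_of_forall_gt (x : ℕ → R) {c : α} {l : List α} (h : ∀ b ∈ l, b < c) :
    schubertAt x (c :: l) = x 0 ^ l.length * schubertAt (fun i => x (i + 1)) l := by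
  have hrow (r : List α) (hr : r.Perm l) : row (desc R α) (x 0) l.length (sortedInd R) (c :: r) =
      (x 0 ^ l.length • sortedInd R : List α → R) r := by
    have hrc : ∀ b ∈ r, b < c := fun b hb => h b (hr.mem_iff.1 hb)
    rw [← hr.length_eq, row_sortedInd_cons_of_forall_gt (x 0) hrc, Pi.smul_apply, smul_eq_mul]
    simp +contextual [sortedInd, List.pairwise_append, hrc]
  rw [schubertAt, List.length_cons, schubertProduct, Module.End.mul_apply,
    schubertProduct_desc_shift_cons, schubertProduct_desc_congr _ _ hrow, map_smul]
  rfl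

theorem schubertAt_of_pairwise_gt (x : ℕ → R) {l : List α} (h : l.Pairwise (· > ·)) :
    schubertAt x l = ∏ i ∈ Finset.range l.length, x i ^ (l.length - 1 - i) := by
  induction l generalizing x with
  | nil => rfl
  | cons c l ih =>
    rw [List.pairwise_cons] at h
    rw [schubertAt_cons_of_forall_gt x h.1, ih _ h.2, List.length_cons, Finset.prod_range_succ',
      mul_comm]
    refine congrArg₂ _ (Finset.prod_congr rfl fun i _ => ?_) rfl
    congr 1
    omega

theorem schubertAt_sub_swap (x : ℕ → R) {i : ℕ} {l r : List α} (h : r ∈ removeDescent i l) :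
    schubertAt x l - schubertAt (x ∘ Equiv.swap i (i + 1)) l =
      (x i - x (i + 1)) * schubertAt x r := by
  have hi : i + 1 < l.length := by
    fun_induction removeDescent i l generalizing r with
    | case1 => simp
    | case2 => cases h
    | case3 i a l ih =>
      obtain ⟨s, hs, -⟩ := Option.mem_map.1 h
      exact Nat.succ_lt_succ (ih hs)
    | case4 => cases h
  have key := congrFun (LinearMap.congr_fun
    (isNilCoxeter_desc.schubertProduct_sub_swap x hi) (sortedInd R)) l
  simp only [LinearMap.sub_apply, LinearMap.smul_apply, Module.End.mul_apply, Pi.sub_apply,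
    Pi.smul_apply, smul_eq_mul, desc_apply, Option.mem_def.1 h, Option.elim_some] at key
  rw [schubertAt, schubertAt, key, schubertAt, (perm_of_mem_removeDescent h).length_eq]

theorem removeDescent_ofFn {n i : ℕ} (f : Fin n → α) (h : i + 1 < n)
    (hf : f ⟨i + 1, h⟩ < f ⟨i, Nat.lt_of_succ_lt h⟩) :
    removeDescent i (List.ofFn f) =
      some (List.ofFn (f ∘ Equiv.swap ⟨i, Nat.lt_of_succ_lt h⟩ ⟨i + 1, h⟩)) := by
  induction i generalizing n with
  | zero =>
    obtain ⟨n, rfl⟩ := Nat.exists_eq_add_of_le' h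
    have hfix (j : Fin n) : Equiv.swap (0 : Fin (n + 2)) 1 j.succ.succ = j.succ.succ :=
      Equiv.swap_apply_of_ne_of_ne (by simp [Fin.ext_iff]) (by simp [Fin.ext_iff])
    simp only [List.ofFn_succ, removeDescent]
    refine (if_pos hf).trans ?_
    simp [hfix]
  | succ i ih =>
    obtain ⟨n, rfl⟩ := Nat.exists_eq_add_of_le' (show 1 ≤ n by omega)
    have hswap (j : Fin n) : Equiv.swap (⟨i + 1, by omega⟩ : Fin (n + 1)) ⟨i + 2, h⟩ j.succ =
        (Equiv.swap ⟨i, by omega⟩ ⟨i + 1, by omega⟩ j).succ := by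
      simp only [Equiv.swap_apply_def, Fin.ext_iff]
      grind
    rw [List.ofFn_succ, removeDescent, ih (fun j => f j.succ) (by omega) hf, List.ofFn_succ]
    simp [hswap, Function.comp_def, Equiv.swap_apply_of_ne_of_ne]

end SchubertAt

section Schubert

open MvPolynomial

theorem divDiff_schubertAt {α : Type*} [LinearOrder α] {i : ℕ} {l r : List α}
    (h : r ∈ removeDescent i l) : divDiff i (schubertAt X l) = schubertAt X r := by
  refine divDiff_unique i _ _ ?_
  have hswap : swapVars i (schubertAt X l) = schubertAt (X ∘ Equiv.swap i (i + 1)) l :=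
    (map_schubertAt (rename (Equiv.swap i (i + 1)) : _ →ₐ[ℤ] _).toRingHom X l).trans
      (congrArg (schubertAt · l) (funext fun j => rename_X _ j))
  rw [hswap, schubertAt_sub_swap X h]

theorem schubert_eq_schubertAt {n : ℕ} (w : Equiv.Perm (Fin n)) :
    schubert w = schubertAt X (List.ofFn w) := by
  classical
  fun_induction schubert w with
  | case1 w h ih =>
    obtain ⟨hi, hlt⟩ := Nat.find_spec h
    rw [ih]
    have hcomp : mulSimple w _ hi ∘ Equiv.swap ⟨_, Nat.lt_of_succ_lt hi⟩ ⟨_, hi⟩ = w := by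
      funext j
      simp [mulSimple]
    refine divDiff_schubertAt ?_
    rw [Option.mem_def, removeDescent_ofFn _ hi (by simpa [mulSimple] using hlt), hcomp]
  | case2 w h =>
    have hdec : (List.ofFn w).Pairwise (· > ·) := by
      rw [← List.isChain_iff_pairwise, List.isChain_iff_getElem]
      intro i hi
      rw [List.length_ofFn] at hi
      simp only [List.getElem_ofFn]
      refine lt_of_le_of_ne (not_lt.1 fun hlt => h ⟨i, hi, hlt⟩) fun he => ?_
      exact absurd (Fin.ext_iff.1 (w.injective he)) (Nat.succ_ne_self i)
    rw [schubertAt_of_pairwise_gt X hdec, List.length_ofFn]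

/-- The principal specialization of the Schubert polynomial of the word `l`. -/
def wordUpsilon {α : Type*} [LinearOrder α] (l : List α) : ℤ := schubertAt (fun _ => 1) l

theorem wordUpsilon_nil {α : Type*} [LinearOrder α] : wordUpsilon ([] : List α) = 1 := by
  rw [wordUpsilon, schubertAt, List.length_nil, schubertProduct, Module.End.one_apply, sortedInd,
    if_pos List.Pairwise.nil]

theorem upsilon_eq_wordUpsilon {n : ℕ} (w : Equiv.Perm (Fin n)) :
    upsilon w = wordUpsilon (List.ofFn w) := by
  rw [upsilon, schubert_eq_schubertAt, map_schubertAt, wordUpsilon]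
  simp only [eval_X]

end Schubert

section Jumps

variable {R α : Type*} [CommRing R] [LinearOrder α]

mutual

/-- Bubble a letter `m` to the left through a word, from its end, in all possible ways: at each
letter `a`, the travelling letter `m` may be left behind and replaced by `a`, or it may jump over
`a`, the latter only if `m < a`. The value `passSum K B L` is the sum of `K` over the resulting
words, where the part of the word still to be traversed is stored in `B` in reverse order, with
the travelling letter as head, and `L` is the part already traversed. -/
def passSum (K : List α → R) : List α → List α → R
  | [], L => K L
  | m :: B, L => passSum K B (m :: L) + jumpSum K B m L

/-- The part of `passSum K (m :: B) L` in which the travelling letter `m` jumps over the next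
letter of the word. -/
def jumpSum (K : List α → R) : List α → α → List α → R
  | [], _, _ => 0
  | a :: B, m, L => if m < a then passSum K B (m :: a :: L) + jumpSum K B m (a :: L) else 0

end

theorem passSum_nil (K : List α → R) (L : List α) : passSum K [] L = K L := by
  rw [passSum]

theorem passSum_cons (K : List α → R) (m : α) (B L : List α) :
    passSum K (m :: B) L = passSum K B (m :: L) + jumpSum K B m L := by
  rw [passSum]

theorem jumpSum_nil (K : List α → R) (m : α) (L : List α) : jumpSum K [] m L = 0 := by
  rw [jumpSum]

theorem jumpSum_cons (K : List α → R) (a m : α) (B L : List α) :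
    jumpSum K (a :: B) m L =
      if m < a then passSum K B (m :: a :: L) + jumpSum K B m (a :: L) else 0 := by
  rw [jumpSum]

theorem passSum_singleton (K : List α → R) (m : α) (L : List α) :
    passSum K [m] L = K (m :: L) := by
  rw [passSum_cons, passSum_nil, jumpSum_nil, add_zero]

theorem passSum_cons_cons (K : List α → R) (m a : α) (B L : List α) :
    passSum K (m :: a :: B) L =
      passSum K (a :: B) (m :: L) + if m < a then passSum K (m :: B) (a :: L) else 0 := by
  rw [passSum_cons K m, jumpSum_cons, passSum_cons K m]

theorem jumpSum_eq_zero (K : List α → R) {B : List α} {m : α} (L : List α)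
    (h : ∀ a ∈ B, ¬ m < a) : jumpSum K B m L = 0 := by
  cases B with
  | nil => exact jumpSum_nil K m L
  | cons a B => rw [jumpSum_cons, if_neg (h a List.mem_cons_self)]

theorem passSum_congr {K K' : List α → R} {B L : List α}
    (h : ∀ l, l.Perm (B ++ L) → K l = K' l) : passSum K B L = passSum K' B L := by
  rcases B with _ | ⟨m, B⟩
  · rw [passSum_nil, passSum_nil, h L (List.Perm.refl L)]
  induction B generalizing m L with
  | nil => rw [passSum_singleton, passSum_singleton, h (m :: L) (List.Perm.refl _)]
  | cons a B ih =>
    have hstay : (a :: B ++ m :: L).Perm (m :: a :: B ++ L) := List.perm_middle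
    have hjump : (m :: B ++ a :: L).Perm (m :: a :: B ++ L) := List.perm_middle.cons m
    rw [passSum_cons_cons, passSum_cons_cons, ih _ fun l hl => h l (hl.trans hstay),
      ih _ fun l hl => h l (hl.trans hjump)]

theorem passSum_append_cons {μ : α} {B : List α} (h : ∀ m ∈ B, μ < m) (K : List α → R)
    (A L : List α) :
    passSum K (B ++ μ :: A) L = passSum (fun r => passSum K (μ :: A) r) B L := by
  rcases B with _ | ⟨m, B⟩
  · rw [passSum_nil, List.nil_append]
  induction B generalizing m L with
  | nil =>
    rw [List.singleton_append, passSum_cons_cons, if_neg (h m List.mem_cons_self).not_gt,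
      add_zero, passSum_singleton]
  | cons a B ih =>
    simp only [List.forall_mem_cons] at h ih
    simp only [List.cons_append] at ih ⊢
    rw [passSum_cons_cons, passSum_cons_cons, ih _ _ h.2, ih _ _ ⟨h.1, h.2.2⟩]

section Minimum

variable {K : List α → R} {μ : α} (hK : ∀ c l, μ ≤ c → μ ∈ l → K (c :: l) = 0)

include hK

theorem passSum_cons_eq_zero {m : α} {A L : List α} (hA : ∀ a ∈ m :: A, μ ≤ a) (hμ : μ ∈ L) :
    passSum K (m :: A) L = 0 := by
  induction A generalizing m L with
  | nil => rw [passSum_singleton, hK m L (hA m List.mem_cons_self) hμ]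
  | cons a A ih =>
    simp only [List.forall_mem_cons] at hA ih
    rw [passSum_cons_cons, ih hA.2 (List.mem_cons_of_mem m hμ),
      ih ⟨hA.1, hA.2.2⟩ (List.mem_cons_of_mem a hμ), ite_self, add_zero]

theorem passSum_cons_of_forall_lt {A : List α} (hA : ∀ a ∈ A, μ < a) (L : List α) :
    passSum K (μ :: A) L = K (μ :: (A.reverse ++ L)) := by
  induction A generalizing L with
  | nil => exact passSum_singleton K μ L
  | cons a A ih =>
    rw [passSum_cons_cons, passSum_cons_eq_zero hK (fun b hb => (hA b hb).le) List.mem_cons_self,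
      if_pos (hA a List.mem_cons_self), ih fun b hb => hA b (List.mem_cons_of_mem a hb), zero_add,
      List.reverse_cons, List.append_assoc, List.singleton_append]

end Minimum

theorem column_desc_apply (G : List α → R) (B : List α) (m : α) (L : List α) :
    column (desc R α) (1 : R) B.length G (B.reverse ++ m :: L) = passSum G (m :: B) L := by
  induction B generalizing m L with
  | nil => exact (passSum_singleton G m L).symm
  | cons a B ih =>
    have hdesc := desc_append B.reverse L a m (column (desc R α) (1 : R) B.length G)
    rw [List.length_reverse] at hdesc
    rw [List.length_cons, column, one_smul, Module.End.mul_apply, LinearMap.add_apply,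
      Module.End.one_apply, Pi.add_apply, List.reverse_cons, List.append_assoc,
      List.singleton_append, hdesc, ih, ih, passSum_cons_cons]

/-- The value of `wordUpsilon` on the words which start with their smallest letter is that of the
rest of the word; on all other non-empty words, this function vanishes. -/
def tailUpsilon : List α → ℤ
  | [] => 1
  | a :: l => aboveInd ℤ a l * wordUpsilon l

theorem wordUpsilon_eq_passSum (l : List α) :
    wordUpsilon l = passSum tailUpsilon l.reverse [] := by
  rcases List.eq_nil_or_concat l with rfl | ⟨B, m, rfl⟩
  · rw [wordUpsilon_nil, List.reverse_nil, passSum_nil, tailUpsilon]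
  have hcol := column_desc_apply (schubertProduct (fun i => desc ℤ α (i + 1)) (fun _ => (1 : ℤ))
    B.reverse.length (sortedInd ℤ)) B.reverse m []
  rw [List.reverse_reverse, List.length_reverse] at hcol
  rw [wordUpsilon, schubertAt, List.concat_eq_append, List.length_append, List.length_singleton,
    isNilCoxeter_desc.schubertProduct_const_succ, Module.End.mul_apply, hcol,
    List.reverse_append, List.reverse_singleton, List.singleton_append]
  refine passSum_congr fun r hr => ?_
  rcases r with _ | ⟨c, r⟩
  · simpa using hr.length_eq
  have hlen : r.length = B.length := by simpa using hr.length_eq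
  rw [schubertProduct_desc_shift_cons, funext (sortedInd_cons c), tailUpsilon, wordUpsilon,
    schubertAt, hlen]
  exact congrFun (schubertProduct_desc_mul (aboveInd_perm c) _ _ (sortedInd ℤ)) r

theorem wordUpsilon_append_cons {μ : α} {A B : List α} (hA : ∀ a ∈ A, μ < a)
    (hB : ∀ b ∈ B, μ < b) :
    wordUpsilon (A ++ μ :: B) = passSum (fun r => wordUpsilon (A ++ r)) B.reverse [] := by
  have hK (c : α) (l : List α) (hc : μ ≤ c) (hμ : μ ∈ l) : tailUpsilon (c :: l) = 0 := by
    rw [tailUpsilon, aboveInd, if_neg fun h => (h μ hμ).not_ge hc, zero_mul]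
  have hA' : ∀ a ∈ A.reverse, μ < a := by simpa only [List.mem_reverse] using hA
  rw [wordUpsilon_eq_passSum, List.reverse_append, List.reverse_cons, List.append_assoc,
    List.singleton_append, passSum_append_cons (by simpa only [List.mem_reverse] using hB)]
  refine passSum_congr fun r hr => ?_
  have hAr : ∀ b ∈ A ++ r, μ < b := by
    refine List.forall_mem_append.2 ⟨hA, fun b hb => hB b ?_⟩
    simpa using hr.mem_iff.1 hb
  rw [passSum_cons_of_forall_lt hK hA', List.reverse_reverse, tailUpsilon, aboveInd, if_pos hAr,
    one_mul]

end Jumps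

section TotallyMonotone

variable {α : Type*} [DecidableEq α]

theorem sum_Icc_neg_one_pow_card_sub_card {U W : Finset α} (h : U ⊆ W) :
    ∑ T ∈ Finset.Icc U W, (-1 : ℤ) ^ (W.card - T.card) = if U = W then 1 else 0 := by
  have hsub : W \ U = ∅ ↔ U = W := by
    rw [Finset.sdiff_eq_empty_iff_subset]
    exact ⟨h.antisymm, fun hUW => hUW.ge⟩
  rw [← if_congr hsub rfl rfl, ← Finset.sum_powerset_neg_one_pow_card]
  refine Finset.sum_nbij' (W \ ·) (W \ ·) ?_ ?_ ?_ ?_ ?_ <;>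
    simp only [Finset.mem_Icc, Finset.mem_powerset, and_imp]
  · exact fun T hUT _ => Finset.sdiff_subset_sdiff subset_rfl hUT
  · refine fun S hS => ⟨?_, Finset.sdiff_subset⟩
    rw [Finset.subset_sdiff]
    exact ⟨h, (Finset.disjoint_sdiff (s := U)).mono_right hS⟩
  · exact fun T _ hTW => Finset.sdiff_sdiff_eq_self hTW
  · exact fun S hS => Finset.sdiff_sdiff_eq_self (hS.trans Finset.sdiff_subset)
  · exact fun T _ hTW => by rw [Finset.card_sdiff_of_subset hTW]

/-- A set function `f` is totally monotone above `F` if its Möbius inverse on the interval from `U`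
on is nonnegative, for every `U` which contains `F`. -/
def TotallyMonotoneAbove (F : Finset α) (f : Finset α → ℤ) : Prop :=
  ∀ U W, F ⊆ U → 0 ≤ ∑ T ∈ Finset.Icc U W, (-1) ^ (W.card - T.card) * f T

namespace TotallyMonotoneAbove

variable {F : Finset α} {f g h : Finset α → ℤ} {a : α}

theorem of_eq_zero (hf : ∀ T, F ⊆ T → f T = 0) : TotallyMonotoneAbove F f := fun U W hU => by
  refine (Finset.sum_eq_zero fun T hT => ?_).ge
  rw [hf T (hU.trans (Finset.mem_Icc.1 hT).1), mul_zero]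

theorem one : TotallyMonotoneAbove F fun _ => 1 := fun U W _ => by
  simp only [mul_one]
  by_cases hUW : U ⊆ W
  · rw [sum_Icc_neg_one_pow_card_sub_card hUW]
    positivity
  · rw [Finset.Icc_eq_empty hUW, Finset.sum_empty]

theorem mono {F' : Finset α} (hf : TotallyMonotoneAbove F f) (hF : F ⊆ F') :
    TotallyMonotoneAbove F' f :=
  fun U W hU => hf U W (hF.trans hU)

theorem add (hf : TotallyMonotoneAbove F f) (hg : TotallyMonotoneAbove F g) :
    TotallyMonotoneAbove F fun T => f T + g T := fun U W hU => by
  simp only [mul_add, Finset.sum_add_distrib]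
  exact add_nonneg (hf U W hU) (hg U W hU)

theorem of_eq_add_ite (hg : TotallyMonotoneAbove F g) (hh : TotallyMonotoneAbove (insert a F) h)
    (hf : ∀ T, F ⊆ T → f T = g T + if a ∈ T then h T else 0) : TotallyMonotoneAbove F f := by
  intro U W hU
  have hsplit : ∑ T ∈ Finset.Icc U W, (-1) ^ (W.card - T.card) * f T =
      ∑ T ∈ Finset.Icc U W, (-1) ^ (W.card - T.card) * g T +
        ∑ T ∈ Finset.Icc (insert a U) W, (-1) ^ (W.card - T.card) * h T := by
    have hIcc : Finset.Icc (insert a U) W = {T ∈ Finset.Icc U W | a ∈ T} := by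
      ext T
      simp only [Finset.mem_Icc, Finset.mem_filter, Finset.insert_subset_iff]
      tauto
    rw [hIcc, Finset.sum_filter, ← Finset.sum_add_distrib]
    refine Finset.sum_congr rfl fun T hT => ?_
    rw [hf T (hU.trans (Finset.mem_Icc.1 hT).1), mul_add, mul_ite, mul_zero]
  rw [hsplit]
  exact add_nonneg (hg U W hU) (hh _ W (Finset.insert_subset_insert a hU))

end TotallyMonotoneAbove

end TotallyMonotone

section Marked

variable {α : Type*}

theorem sublist_append_swap {l P Q : List α} {m a : α} (h : l <+ P ++ m :: a :: Q) :
    l <+ P ++ a :: m :: Q ∨ ∃ p q, l = p ++ m :: a :: q ∧ p <+ P ∧ q <+ Q := by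
  obtain ⟨p, l', rfl, hp, hl'⟩ := List.sublist_append_iff.1 h
  rcases List.sublist_cons_iff.1 hl' with hl' | ⟨r, rfl, hr⟩
  · exact Or.inl (hp.append (hl'.trans ((List.sublist_cons_self m Q).cons_cons a)))
  rcases List.sublist_cons_iff.1 hr with hr | ⟨q, rfl, hq⟩
  · exact Or.inl (hp.append ((hr.cons_cons m).cons a))
  · exact Or.inr ⟨p, q, rfl, hp, hq⟩

variable [LinearOrder α]

/-- The set `F` contains the letter in the role of `2` of every occurrence of the pattern `1423`
in the word `W`. -/
def Marked (F : Finset α) (W : List α) : Prop :=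
  ∀ x c a b, [x, c, a, b] <+ W → x < a → a < b → b < c → a ∈ F

theorem Marked.mono {F F' : Finset α} {W : List α} (h : Marked F W) (hF : F ⊆ F') :
    Marked F' W :=
  fun x c a b hs hxa hab hbc => hF (h x c a b hs hxa hab hbc)

theorem Marked.sublist {F : Finset α} {W W' : List α} (h : Marked F W) (hW : W' <+ W) :
    Marked F W' :=
  fun x c a b hs => h x c a b (hs.trans hW)

/-- A new occurrence of `1423` uses the ascent `m a`. If this ascent is the `14` of the occurrence,
then `μ` can replace `m`, and if it is the `23`, then `m` is marked. -/
theorem Marked.swap {F : Finset α} {P Q : List α} {μ m a : α} (h : Marked F (P ++ a :: m :: Q))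
    (hμP : μ ∈ P) (hμQ : ∀ q ∈ Q, μ < q) (hma : m < a) (hm : m ∈ F) :
    Marked F (P ++ m :: a :: Q) := by
  intro x c a' b hs hxa hab hbc
  rcases sublist_append_swap hs with hs | ⟨p, q, heq, -, hq⟩
  · exact h x c a' b hs hxa hab hbc
  have hcases : (x = m ∧ c = a ∧ [a', b] = q) ∨ (c = m ∧ a' = a) ∨ a' = m := by
    rcases p with _ | ⟨_, _ | ⟨_, _ | ⟨_, _ | ⟨_, p⟩⟩⟩⟩ <;> grind
  rcases hcases with ⟨-, rfl, rfl⟩ | ⟨rfl, rfl⟩ | rfl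
  · refine h μ c a' b ?_ (hμQ a' (hq.mem List.mem_cons_self)) hab hbc
    exact (List.singleton_sublist.2 hμP).append ((hq.cons m).cons_cons c)
  · exact absurd hma (hab.trans hbc).not_gt
  · exact hm

end Marked

section Restrict

variable {α : Type*} [DecidableEq α]

/-- The subword of `l` formed by its letters in `T`. -/
def restrict (T : Finset α) (l : List α) : List α :=
  l.filter (· ∈ T)

theorem restrict_sublist (T : Finset α) (l : List α) : restrict T l <+ l :=
  List.filter_sublist

theorem restrict_nil (T : Finset α) : restrict T [] = [] :=
  List.filter_nil

theorem restrict_append (T : Finset α) (l l' : List α) :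
    restrict T (l ++ l') = restrict T l ++ restrict T l' :=
  List.filter_append l l'

theorem restrict_reverse (T : Finset α) (l : List α) :
    restrict T l.reverse = (restrict T l).reverse :=
  List.filter_reverse

theorem restrict_cons_of_mem {T : Finset α} {a : α} (h : a ∈ T) (l : List α) :
    restrict T (a :: l) = a :: restrict T l :=
  List.filter_cons_of_pos (decide_eq_true h)

theorem restrict_cons_of_notMem {T : Finset α} {a : α} (h : a ∉ T) (l : List α) :
    restrict T (a :: l) = restrict T l :=
  List.filter_cons_of_neg (mt of_decide_eq_true h)

theorem restrict_toFinset_of_sublist {l W : List α} (hW : W.Nodup) (h : l <+ W) :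
    restrict l.toFinset W = l := by
  have hl : l <+ restrict l.toFinset W := by
    have hfilter := h.filter (· ∈ l.toFinset)
    rwa [List.filter_eq_self.2 (by simp)] at hfilter
  refine (hl.eq_of_length_le (List.Subperm.length_le ?_)).symm
  exact List.subperm_of_subset (hW.sublist (restrict_sublist _ W)) fun x hx =>
    List.mem_toFinset.1 (of_decide_eq_true (List.mem_filter.1 hx).2)

theorem restrict_sublist_restrict {S T : Finset α} (h : S ⊆ T) (W : List α) :
    restrict S W <+ restrict T W :=
  List.monotone_filter_right W fun _ ha => decide_eq_true (h (of_decide_eq_true ha))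

theorem toFinset_restrict {T : Finset α} {W : List α} (h : T ⊆ W.toFinset) :
    (restrict T W).toFinset = T := by
  ext x
  simpa [restrict] using fun hx => List.mem_toFinset.1 (h hx)

theorem length_restrict {T : Finset α} {W : List α} (hW : W.Nodup) (h : T ⊆ W.toFinset) :
    (restrict T W).length = T.card := by
  rw [← List.toFinset_card_of_nodup (hW.sublist (restrict_sublist T W)), toFinset_restrict h]

theorem toFinset_subset_of_sublist {l l' : List α} (h : l <+ l') : l.toFinset ⊆ l'.toFinset :=
  fun _ hx => List.mem_toFinset.2 (h.mem (List.mem_toFinset.1 hx))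

end Restrict

section TotalMonotonicity

variable {α : Type*} [LinearOrder α] {A Z₀ : List α} {μ : α}

/-- Total monotonicity of what `passSum` contributes to `Υ` in excess of the word in which nothing
jumps, as a function of the letters kept. Here `A` is the part of the word to the left of its
smallest letter, and `B` and `R` are as for `passSum`. -/
def PassMonotone (A : List α) (F : Finset α) (B R : List α) : Prop :=
  TotallyMonotoneAbove F fun T =>
    passSum (fun r => wordUpsilon (restrict T A ++ r)) (restrict T B) (restrict T R) -
      wordUpsilon (restrict T (A ++ (B.reverse ++ R)))

/-- Total monotonicity of what `jumpSum` contributes to `Υ`, as a function of the letters kept; the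
travelling letter `m` itself is always kept. -/
def JumpMonotone (A : List α) (F : Finset α) (B : List α) (m : α) (R : List α) : Prop :=
  TotallyMonotoneAbove F fun T =>
    jumpSum (fun r => wordUpsilon (restrict T A ++ r)) (restrict T B) m (restrict T R)

theorem PassMonotone.cons {F : Finset α} {a : α} {B R : List α}
    (hpass : PassMonotone A F B (a :: R)) (hjump : JumpMonotone A (insert a F) B a R) :
    PassMonotone A F (a :: B) R := by
  refine TotallyMonotoneAbove.of_eq_add_ite (a := a) hpass hjump fun T _ => ?_
  rw [List.reverse_cons, List.append_assoc, List.singleton_append]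
  by_cases ha : a ∈ T
  · simp only [restrict_cons_of_mem ha, passSum_cons, if_pos ha]
    ring
  · simp only [restrict_cons_of_notMem ha, if_neg ha, add_zero]

theorem JumpMonotone.cons_of_lt {F : Finset α} {a m : α} {B R : List α} (hm : m ∈ F)
    (hma : m < a)
    (hΥ : TotallyMonotoneAbove F fun T =>
      wordUpsilon (restrict T (A ++ (B.reverse ++ m :: a :: R))))
    (hpass : PassMonotone A F B (m :: a :: R)) (hjump : JumpMonotone A F B m (a :: R)) :
    JumpMonotone A F (a :: B) m R := by
  refine TotallyMonotoneAbove.of_eq_add_ite (a := a) hjump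
    ((hpass.add hΥ).mono (Finset.subset_insert a F)) fun T hT => ?_
  by_cases ha : a ∈ T
  · simp only [restrict_cons_of_mem ha,
      restrict_cons_of_mem (hT hm), jumpSum_cons, if_pos hma, if_pos ha]
    ring
  · simp only [restrict_cons_of_notMem ha, if_neg ha, add_zero]

theorem JumpMonotone.cons_of_le {F : Finset α} {a m : α} {B R : List α} (hm : m ∈ F) (ham : a ≤ m)
    (hB : ∀ c ∈ B, m < c → a < m → a ∈ F) : JumpMonotone A F (a :: B) m R := by
  refine TotallyMonotoneAbove.of_eq_zero fun T hT => ?_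
  by_cases ha : a ∈ T
  · rw [restrict_cons_of_mem ha, jumpSum_cons, if_neg ham.not_gt]
  · rw [restrict_cons_of_notMem ha]
    refine jumpSum_eq_zero _ _ fun c hc hmc => ha (hT (hB c ((restrict_sublist T _).mem hc) hmc ?_))
    exact ham.lt_of_ne fun ham => ha (ham ▸ hT hm)

theorem passMonotone_and_jumpMonotone (hμ : ∀ z ∈ Z₀, μ < z)
    (hΥ : ∀ F Z, Z ~ Z₀ → Marked F (A ++ Z) →
      TotallyMonotoneAbove F fun T => wordUpsilon (restrict T (A ++ Z)))
    (B : List α) :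
    (∀ F R, B.reverse ++ R ~ Z₀ → Marked F (A ++ μ :: (B.reverse ++ R)) →
      PassMonotone A F B R) ∧
    ∀ F m R, B.reverse ++ m :: R ~ Z₀ → Marked F (A ++ μ :: (B.reverse ++ m :: R)) → m ∈ F →
      JumpMonotone A F B m R := by
  induction B with
  | nil =>
    refine ⟨fun F R _ _ => .of_eq_zero fun T _ => ?_, fun F m R _ _ _ => .of_eq_zero fun T _ => ?_⟩
    · rw [restrict_nil, passSum_nil, List.reverse_nil, List.nil_append, restrict_append,
        sub_self]
    · rw [restrict_nil, jumpSum_nil]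
  | cons a B ih =>
    obtain ⟨hpass, hjump⟩ := ih
    simp only [List.reverse_cons, List.append_assoc, List.singleton_append]
    constructor
    · intro F R hperm hF
      exact (hpass F (a :: R) hperm hF).cons (hjump _ a R hperm
        (hF.mono (Finset.subset_insert a F)) (Finset.mem_insert_self a F))
    intro F m R hperm hF hm
    rcases lt_or_ge m a with hma | ham
    · have hperm' : B.reverse ++ m :: a :: R ~ Z₀ :=
        ((List.Perm.swap a m R).append_left B.reverse).trans hperm
      have hF' : Marked F (A ++ μ :: (B.reverse ++ m :: a :: R)) := by
        have hR : ∀ r ∈ R, μ < r := fun r hr => hμ r (hperm.subset (by simp [hr]))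
        have hswap := Marked.swap (P := A ++ μ :: B.reverse) (μ := μ) (a := a) (Q := R) (m := m)
          (F := F) (by simpa using hF) (by simp) hR hma hm
        simpa using hswap
      exact .cons_of_lt hm hma
        (hΥ F _ hperm' (hF'.sublist ((List.sublist_cons_self μ _).append_left A)))
        (hpass F _ hperm' hF') (hjump F m _ hperm' hF' hm)
    · refine .cons_of_le hm ham fun c hc hmc ham => hF μ c a m ?_ ?_ ham hmc
      · have hc' : [c] <+ B.reverse := by simpa using hc
        exact (((hc'.append ((List.nil_sublist R).cons_cons m |>.cons_cons a)).cons_cons μ).trans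
          (List.sublist_append_right A _))
      · exact hμ a (hperm.subset (by simp))

theorem exists_eq_append_cons_of_nodup {W : List α} (hne : W ≠ []) (hW : W.Nodup) :
    ∃ A μ B, W = A ++ μ :: B ∧ (∀ a ∈ A, μ < a) ∧ ∀ b ∈ B, μ < b := by
  obtain ⟨μ, hμ, hmin⟩ := W.toFinset.exists_min_image id (by simpa using hne)
  simp only [List.mem_toFinset, id] at hμ hmin
  obtain ⟨A, B, rfl⟩ := List.append_of_mem hμ
  have hnot : μ ∉ A ++ B := (List.nodup_cons.1 (List.perm_middle.nodup_iff.1 hW)).1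
  simp only [List.mem_append, not_or] at hnot
  exact ⟨A, μ, B, rfl, fun a ha => (hmin a (by simp [ha])).lt_of_ne fun h => hnot.1 (h ▸ ha),
    fun b hb => (hmin b (by simp [hb])).lt_of_ne fun h => hnot.2 (h ▸ hb)⟩

theorem totallyMonotoneAbove_wordUpsilon {F : Finset α} {W : List α} (hW : W.Nodup)
    (hF : Marked F W) : TotallyMonotoneAbove F fun T => wordUpsilon (restrict T W) := by
  induction hn : W.length generalizing F W with
  | zero =>
    obtain rfl := List.length_eq_zero_iff.1 hn
    simpa only [restrict_nil, wordUpsilon_nil] using TotallyMonotoneAbove.one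
  | succ n ih =>
    obtain ⟨A, μ, B, rfl, hA, hB⟩ :=
      exists_eq_append_cons_of_nodup (List.length_pos_iff.1 (hn ▸ n.succ_pos)) hW
    have hAB : A ++ B <+ A ++ μ :: B := (List.sublist_cons_self μ B).append_left A
    have hlen : (A ++ B).length = n := by
      simpa only [List.length_append, List.length_cons, ← add_assoc, Nat.succ_inj] using hn
    have hpass : PassMonotone A F B.reverse [] := by
      refine (passMonotone_and_jumpMonotone hB (fun F Z hZ hFZ => ?_) B.reverse).1 F [] (by simp)
        (by simpa using hF)
      have hperm : A ++ Z ~ A ++ B := hZ.append_left A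
      exact ih (hperm.nodup_iff.2 (hW.sublist hAB)) hFZ (hperm.length_eq.trans hlen)
    refine .of_eq_add_ite (a := μ) (ih (hW.sublist hAB) (hF.sublist hAB) hlen)
      (hpass.mono (Finset.subset_insert μ F)) fun T _ => ?_
    simp only [restrict_append, List.reverse_reverse, List.append_nil]
    by_cases hμ : μ ∈ T
    · rw [restrict_cons_of_mem hμ, wordUpsilon_append_cons, if_pos hμ,
        restrict_reverse, restrict_nil]
      · ring
      · exact fun a ha => hA a ((restrict_sublist T _).mem ha)
      · exact fun b hb => hB b ((restrict_sublist T _).mem hb)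
    · rw [restrict_cons_of_notMem hμ, if_neg hμ, add_zero]

end TotalMonotonicity

section Subwords

variable {u W : List ℕ}

theorem sum_wordsBetween_eq_sum_Icc (hW : W.Nodup) (hu : u <+ W) (f : List ℕ → ℤ) :
    ∑ v ∈ wordsBetween u W, f v = ∑ T ∈ Finset.Icc u.toFinset W.toFinset, f (restrict T W) := by
  refine Finset.sum_nbij' List.toFinset (restrict · W) ?_ ?_ ?_ ?_ ?_ <;>
    simp only [Finset.mem_Icc, mem_wordsBetween, and_imp]
  · exact fun v huv hvW => ⟨toFinset_subset_of_sublist huv, toFinset_subset_of_sublist hvW⟩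
  · intro T huT _
    refine ⟨?_, restrict_sublist T W⟩
    nth_rewrite 1 [← restrict_toFinset_of_sublist hW hu]
    exact restrict_sublist_restrict huT W
  · exact fun v _ hvW => restrict_toFinset_of_sublist hW hvW
  · exact fun T _ hTW => toFinset_restrict hTW
  · exact fun v _ hvW => by rw [restrict_toFinset_of_sublist hW hvW]

theorem sum_wordsBetween_neg_one_pow_mul (hW : W.Nodup) (hu : u <+ W) (f : List ℕ → ℤ) :
    ∑ v ∈ wordsBetween u W, (-1) ^ (W.length - v.length) * f v =
      ∑ T ∈ Finset.Icc u.toFinset W.toFinset,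
        (-1) ^ (W.toFinset.card - T.card) * f (restrict T W) := by
  rw [sum_wordsBetween_eq_sum_Icc hW hu]
  refine Finset.sum_congr rfl fun T hT => ?_
  rw [length_restrict hW (Finset.mem_Icc.1 hT).2, List.toFinset_card_of_nodup hW]

theorem sum_wordsBetween_neg_one_pow (hW : W.Nodup) (hu : u <+ W) :
    ∑ v ∈ wordsBetween u W, (-1 : ℤ) ^ (W.length - v.length) = if u = W then 1 else 0 := by
  have hiff : u.toFinset = W.toFinset ↔ u = W := by
    refine ⟨fun h => ?_, congrArg _⟩
    rw [← restrict_toFinset_of_sublist hW hu, h, restrict_toFinset_of_sublist hW (.refl W)]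
  have hsum := sum_wordsBetween_neg_one_pow_mul hW hu fun _ => 1
  simp only [mul_one] at hsum
  rw [hsum, sum_Icc_neg_one_pow_card_sub_card (toFinset_subset_of_sublist hu),
    if_congr hiff rfl rfl]

theorem sum_wordsBetween_wordUpsilon_nonneg (hW : W.Nodup) (hu : u <+ W)
    (hF : Marked u.toFinset W) :
    0 ≤ ∑ v ∈ wordsBetween u W, (-1) ^ (W.length - v.length) * wordUpsilon v := by
  rw [sum_wordsBetween_neg_one_pow_mul hW hu]
  exact totallyMonotoneAbove_wordUpsilon hW hF _ _ subset_rfl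

end Subwords

section WordCoeff

variable {α β : Type*} [LinearOrder α] [LinearOrder β]

theorem wordUpsilon_map {f : α → β} (hf : StrictMono f) (l : List α) :
    wordUpsilon (l.map f) = wordUpsilon l :=
  schubertAt_map hf _ l

/-- The Möbius inverse of `wordUpsilon` with respect to the order by subwords. By
`coeffC_eq_wordCoeff`, this is `coeffC` of the permutation with the same relative order. -/
def wordCoeff (l : List α) : ℤ :=
  (l.sublists.map fun v => (-1) ^ (l.length - v.length) * wordUpsilon v).sum

theorem wordCoeff_map {f : α → β} (hf : StrictMono f) (l : List α) :
    wordCoeff (l.map f) = wordCoeff l := by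
  simp only [wordCoeff, List.sublists_map, List.map_map, Function.comp_def, List.length_map,
    wordUpsilon_map hf]

variable {W : List ℕ}

theorem wordCoeff_eq_sum (hW : W.Nodup) :
    wordCoeff W = ∑ v ∈ wordsBetween [] W, (-1) ^ (W.length - v.length) * wordUpsilon v := by
  have hwords : wordsBetween [] W = W.sublists.toFinset :=
    Finset.filter_true_of_mem fun v _ => List.nil_sublist v
  rw [hwords, List.sum_toFinset _ (List.nodup_sublists.2 hW), wordCoeff]

theorem wordCoeff_nonneg (hW : W.Nodup) (hF : Marked ∅ W) : 0 ≤ wordCoeff W := by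
  rw [wordCoeff_eq_sum hW]
  exact sum_wordsBetween_wordUpsilon_nonneg hW (List.nil_sublist W) hF

theorem sum_wordCoeff (hW : W.Nodup) : ∑ l ∈ wordsBetween [] W, wordCoeff l = wordUpsilon W := by
  have hsign {u l : List ℕ} (hul : u <+ l) (hlW : l <+ W) : (-1 : ℤ) ^ (l.length - u.length) =
      (-1) ^ (W.length - u.length) * (-1) ^ (W.length - l.length) := by
    rw [← Nat.sub_add_sub_cancel hlW.length_le hul.length_le, pow_add, mul_right_comm, ← mul_pow,
      neg_one_mul, neg_neg, one_pow, one_mul]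
  calc ∑ l ∈ wordsBetween [] W, wordCoeff l
      = ∑ l ∈ wordsBetween [] W, ∑ u ∈ wordsBetween [] l,
          (-1) ^ (l.length - u.length) * wordUpsilon u :=
        Finset.sum_congr rfl fun l hl =>
          wordCoeff_eq_sum (hW.sublist ((mem_wordsBetween [] l W).1 hl).2)
    _ = ∑ u ∈ wordsBetween [] W, ∑ l ∈ wordsBetween u W,
          (-1) ^ (l.length - u.length) * wordUpsilon u := by
        refine Finset.sum_comm' fun l u => ?_
        simp only [mem_wordsBetween, List.nil_sublist, true_and]
        exact ⟨fun h => ⟨⟨h.2, h.1⟩, h.2.trans h.1⟩, fun h => ⟨h.1.2, h.1.1⟩⟩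
    _ = ∑ u ∈ wordsBetween [] W, if u = W then wordUpsilon u else 0 := by
        refine Finset.sum_congr rfl fun u hu => ?_
        have huW := ((mem_wordsBetween [] u W).1 hu).2
        have hfactor : ∀ l ∈ wordsBetween u W, (-1) ^ (l.length - u.length) * wordUpsilon u =
            (-1) ^ (W.length - u.length) * wordUpsilon u * (-1) ^ (W.length - l.length) := by
          intro l hl
          obtain ⟨hul, hlW⟩ := (mem_wordsBetween u l W).1 hl
          rw [hsign hul hlW, mul_right_comm]
        rw [Finset.sum_congr rfl hfactor, ← Finset.mul_sum, sum_wordsBetween_neg_one_pow hW huW]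
        split_ifs with h
        · rw [h, Nat.sub_self, pow_zero, one_mul, mul_one]
        · rw [mul_zero]
    _ = wordUpsilon W := by
        rw [Finset.sum_ite_eq', if_pos]
        exact (mem_wordsBetween [] W W).2 ⟨List.nil_sublist W, .refl W⟩

end WordCoeff

section Standardization

theorem length_oneLine {n : ℕ} (w : Equiv.Perm (Fin n)) : (oneLine w).length = n :=
  List.length_ofFn

theorem oneLine_eq_map {n : ℕ} (w : Equiv.Perm (Fin n)) :
    oneLine w = (List.ofFn w).map fun i : Fin n => (i : ℕ) + 1 := by
  rw [oneLine, List.map_ofFn, Function.comp_def]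

theorem strictMono_fin_val_succ (n : ℕ) : StrictMono fun i : Fin n => (i : ℕ) + 1 :=
  fun _ _ h => Nat.succ_lt_succ h

theorem nodup_oneLine {n : ℕ} (w : Equiv.Perm (Fin n)) : (oneLine w).Nodup := by
  rw [oneLine_eq_map]
  exact (List.nodup_ofFn.2 w.injective).map (strictMono_fin_val_succ n).injective

theorem oneLine_sigma_injective :
    Function.Injective fun p : Σ n, Equiv.Perm (Fin n) => oneLine p.2 := by
  rintro ⟨n, v⟩ ⟨m, w⟩ h
  replace h : oneLine v = oneLine w := h
  obtain rfl : n = m := by rw [← length_oneLine v, ← length_oneLine w, h]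
  refine congrArg _ (Equiv.ext fun i => Fin.ext ?_)
  simpa using congrFun (List.ofFn_injective h) i

theorem oneLine_wordPerm_of_eq_map {n : ℕ} {v : Equiv.Perm (Fin n)} {e : Fin n → ℕ}
    (he : StrictMono e) {l : List ℕ} (hl : l = (List.ofFn v).map e) :
    oneLine (wordPerm l) = oneLine v := by
  obtain rfl : n = l.length := by rw [hl, List.length_map, List.length_ofFn]
  have hget : l.get = e ∘ v := List.ofFn_injective (by rw [List.ofFn_get, ← List.map_ofFn, ← hl])
  have hmono : StrictMono (l.get ∘ ⇑v⁻¹) := by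
    have hcomp : l.get ∘ ⇑v⁻¹ = e := by
      ext i
      simp [hget]
    rwa [hcomp]
  have hsort : v⁻¹ = Tuple.sort l.get :=
    Tuple.eq_sort_iff.2 ⟨hmono.monotone, fun _ _ hij heq => absurd heq (hmono hij).ne⟩
  rw [wordPerm, ← hsort, inv_inv]

theorem exists_strictMono_eq_map_wordPerm {l : List ℕ} (hl : l.Nodup) :
    ∃ e : Fin l.length → ℕ, StrictMono e ∧ l = (List.ofFn (wordPerm l)).map e := by
  refine ⟨l.get ∘ Tuple.sort l.get, ?_, ?_⟩
  · exact (Tuple.monotone_sort l.get).strictMono_of_injective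
      ((List.nodup_iff_injective_get.1 hl).comp (Tuple.sort l.get).injective)
  · rw [List.map_ofFn, wordPerm, Function.comp_assoc, ← Equiv.Perm.coe_mul, mul_inv_cancel,
      Equiv.Perm.coe_one, Function.comp_id, List.ofFn_get]

theorem upsilon_wordPerm {l : List ℕ} (hl : l.Nodup) : upsilon (wordPerm l) = wordUpsilon l := by
  obtain ⟨e, he, hl⟩ := exists_strictMono_eq_map_wordPerm hl
  conv_rhs => rw [hl, wordUpsilon_map he]
  exact upsilon_eq_wordUpsilon _

theorem wordCoeff_oneLine_wordPerm {l : List ℕ} (hl : l.Nodup) :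
    wordCoeff (oneLine (wordPerm l)) = wordCoeff l := by
  obtain ⟨e, he, hl⟩ := exists_strictMono_eq_map_wordPerm hl
  conv_rhs => rw [hl, wordCoeff_map he]
  rw [oneLine_eq_map, wordCoeff_map (strictMono_fin_val_succ _)]

theorem upsilon_eq_wordUpsilon_oneLine {n : ℕ} (w : Equiv.Perm (Fin n)) :
    upsilon w = wordUpsilon (oneLine w) := by
  rw [upsilon_eq_wordUpsilon, oneLine_eq_map, wordUpsilon_map (strictMono_fin_val_succ n)]

theorem Avoids1423.marked {n : ℕ} {w : Equiv.Perm (Fin n)} (hw : Avoids1423 w) :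
    Marked ∅ (oneLine w) := by
  intro x c a b hs hxa hab hbc
  let v : Equiv.Perm (Fin 4) := ⟨![0, 3, 1, 2], ![0, 2, 3, 1], by decide, by decide⟩
  have he : StrictMono ![x, a, b, c] := by
    rw [Fin.strictMono_iff_lt_succ]
    intro i
    fin_cases i <;> simpa
  exact absurd (oneLine_wordPerm_of_eq_map (v := v) he rfl) (hw _ hs)

end Standardization

section Coefficients

variable {n : ℕ} (w : Equiv.Perm (Fin n))

theorem sum_mul_patternCount (f : List ℕ → ℤ) (k : ℕ) :
    ∑ m ∈ Finset.range k, ∑ v : Equiv.Perm (Fin m), f (oneLine v) * patternCount v w =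
      ∑ l ∈ wordsBetween [] (oneLine w) with l.length < k, f (oneLine (wordPerm l)) := by
  let standardize (l : List ℕ) : Σ m, Equiv.Perm (Fin m) := ⟨l.length, wordPerm l⟩
  have hmaps : ∀ l ∈ {l ∈ wordsBetween [] (oneLine w) | l.length < k},
      standardize l ∈ (Finset.range k).sigma fun _ => Finset.univ :=
    fun l hl => Finset.mem_sigma.2
      ⟨Finset.mem_range.2 (Finset.mem_filter.1 hl).2, Finset.mem_univ _⟩
  rw [Finset.sum_sigma', ← Finset.sum_fiberwise_of_maps_to hmaps]
  refine Finset.sum_congr rfl fun p hp => ?_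
  have hfiber : {l ∈ {l ∈ wordsBetween [] (oneLine w) | l.length < k} | standardize l = p} =
      {l ∈ wordsBetween [] (oneLine w) | oneLine (wordPerm l) = oneLine p.2} := by
    rw [Finset.filter_filter]
    refine Finset.filter_congr fun l _ => ?_
    rw [← oneLine_sigma_injective.eq_iff, and_iff_right_iff_imp]
    intro h
    rw [← length_oneLine (wordPerm l)]
    exact (congrArg List.length h).trans_lt
      ((length_oneLine p.2).trans_lt (Finset.mem_range.1 (Finset.mem_sigma.1 hp).1))
  rw [hfiber, Finset.sum_congr rfl fun l hl => congrArg f (Finset.mem_filter.1 hl).2,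
    Finset.sum_const, nsmul_eq_mul, mul_comm, patternCount]

theorem sum_wordCoeff_mul_patternCount (k : ℕ) :
    ∑ m ∈ Finset.range k, ∑ v : Equiv.Perm (Fin m), wordCoeff (oneLine v) * patternCount v w =
      ∑ l ∈ wordsBetween [] (oneLine w) with l.length < k, wordCoeff l := by
  rw [sum_mul_patternCount]
  refine Finset.sum_congr rfl fun l hl => wordCoeff_oneLine_wordPerm ((nodup_oneLine w).sublist ?_)
  exact ((mem_wordsBetween _ _ _).1 (Finset.mem_filter.1 hl).1).2

theorem upsilon_eq_sum_wordCoeff_mul_patternCount :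
    upsilon w = ∑ m ∈ Finset.range (n + 1), ∑ v : Equiv.Perm (Fin m),
      wordCoeff (oneLine v) * patternCount v w := by
  rw [sum_wordCoeff_mul_patternCount, upsilon_eq_wordUpsilon_oneLine,
    ← sum_wordCoeff (nodup_oneLine w), Finset.filter_true_of_mem]
  intro l hl
  rw [Nat.lt_succ_iff, ← length_oneLine w]
  exact ((mem_wordsBetween _ _ _).1 hl).2.length_le

theorem coeffC_eq_wordCoeff : coeffC w = wordCoeff (oneLine w) := by
  induction n using Nat.strong_induction_on with | _ n ih =>
  rcases n with _ | n
  · rw [coeffC, oneLine, List.ofFn_zero, wordCoeff, List.sublists_nil, List.map_singleton,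
      List.sum_singleton, wordUpsilon_nil, Nat.sub_self, pow_zero, one_mul]
  have hproper : {l ∈ wordsBetween [] (oneLine w) | l.length < n + 1} =
      (wordsBetween [] (oneLine w)).erase (oneLine w) := by
    rw [← Finset.filter_ne']
    refine Finset.filter_congr fun l hl => ?_
    have hlw := ((mem_wordsBetween _ _ _).1 hl).2
    have hlen : l.length ≤ n + 1 := hlw.length_le.trans_eq (length_oneLine w)
    rw [hlen.lt_iff_ne, not_iff_not]
    exact ⟨fun h => hlw.eq_of_length (h.trans (length_oneLine w).symm),
      fun h => h ▸ length_oneLine w⟩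
  have hrec : ∑ m : Fin (n + 1), ∑ v : Equiv.Perm (Fin m), coeffC v * (patternCount v w : ℤ) =
      ∑ l ∈ (wordsBetween [] (oneLine w)).erase (oneLine w), wordCoeff l := by
    rw [← hproper, ← sum_wordCoeff_mul_patternCount, Finset.sum_range]
    exact Fintype.sum_congr _ _ fun m => Fintype.sum_congr _ _ fun v => by rw [ih m m.isLt v]
  rw [coeffC, hrec, upsilon_eq_wordUpsilon_oneLine, ← sum_wordCoeff (nodup_oneLine w),
    sub_eq_iff_eq_add, Finset.add_sum_erase]
  exact (mem_wordsBetween _ _ _).2 ⟨List.nil_sublist _, .refl _⟩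

end Coefficients

end SchubertSpec

end

theorem corollary1p6 {n : ℕ} (w : Equiv.Perm (Fin n)) (hw : SchubertSpec.Avoids1423 w) :
    (∀ u : List ℕ, List.Sublist u (SchubertSpec.oneLine w) →
      0 ≤ ∑ v ∈ SchubertSpec.wordsBetween u (SchubertSpec.oneLine w),
        (-1 : ℤ) ^ (n - v.length) * SchubertSpec.upsilon (SchubertSpec.wordPerm v)) ∧
    0 ≤ SchubertSpec.coeffC w ∧
    (SchubertSpec.upsilon w = ∑ m ∈ Finset.range (n + 1), ∑ v : Equiv.Perm (Fin m),
        SchubertSpec.coeffC v * (SchubertSpec.patternCount v w : ℤ)) ∧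
    (∀ (m : ℕ) (v : Equiv.Perm (Fin m)),
      0 < SchubertSpec.patternCount v w → 0 ≤ SchubertSpec.coeffC v) := by
  open SchubertSpec in
  have hnodup := nodup_oneLine w
  refine ⟨fun u hu => ?_, ?_, ?_, fun m v hv => ?_⟩
  · have hmarked := hw.marked.mono (Finset.empty_subset u.toFinset)
    refine (sum_wordsBetween_wordUpsilon_nonneg hnodup hu hmarked).trans_eq
      (Finset.sum_congr rfl fun v hv => ?_)
    have hvw := ((mem_wordsBetween _ _ _).1 hv).2
    rw [length_oneLine, upsilon_wordPerm (hnodup.sublist hvw)]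
  · rw [coeffC_eq_wordCoeff]
    exact wordCoeff_nonneg hnodup hw.marked
  · simp only [coeffC_eq_wordCoeff]
    exact upsilon_eq_sum_wordCoeff_mul_patternCount w
  · obtain ⟨l, hl⟩ := Finset.card_pos.1 hv
    obtain ⟨hl, hlv⟩ := Finset.mem_filter.1 hl
    have hlw := ((mem_wordsBetween _ _ _).1 hl).2
    rw [coeffC_eq_wordCoeff, ← hlv, wordCoeff_oneLine_wordPerm (hnodup.sublist hlw)]
    exact wordCoeff_nonneg (hnodup.sublist hlw) (hw.marked.sublist hlw)
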